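/- Theorem (FDR bound for naive selection). Let ${\bf X}\in\mathbb{R}^{n\times p}$ be a fixed design matrix whose columns have Euclidean norm $1$ and for which $\boldsymbol\Sigma={\bf X}^\top{\bf X}$ is invertible, and let ${\bf y}={\bf X}\boldsymbol\beta+{\bf w}$ with ${\bf w}\sim\mathcal N(0,\sigma^2{\bf I}_n)$, $\sigma>0$, $\boldsymbol\beta\in\mathbb{R}^p$. Let $\widetilde{\bf X}\in\mathbb{R}^{n\times p}$ be a knockoff matrix, that is, for some ${\bf s}\in\mathbb{R}^p_+$, $${\bf G}:=[{\bf X}\ \widetilde{\bf X}]^\top[{\bf X}\ \widetilde{\bf X}]=\begin{bmatrix}\boldsymbol\Sigma&\boldsymbol\Sigma-\mathrm{diag}\{{\bf s}\}\\ \boldsymbol\Sigma-\mathrm{diag}\{{\bf s}\}&\boldsymbol\Sigma\end{bmatrix}.$$ Put $(\boldsymbol\gamma,\boldsymbol\gamma')=[{\bf X}\ \widetilde{\bf X}]^\top{\bf y}\in\mathbb{R}^{p}\times\mathbb{R}^p$. For $F\subseteq\{1,\dots,p\}$ let $P_F$ be the permutation of the coordinates of $\mathbb{R}^{2p}$ that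 swaps the coordinates $i$ and $i+p$ for all $i\in F$, and write $P_i=P_{\{i\}}$. Let $\hat{\boldsymbol\theta}=\mathcal T({\bf G},[{\bf X}\ \widetilde{\bf X}]^\top{\bf y})\in\mathbb{R}^{2p}$, where $\mathcal T$ is a deterministic operator, measurable in its second argument, with $\mathcal T({\bf G},P_i[{\bf X}\ \widetilde{\bf X}]^\top{\bf y})=P_i\,\mathcal T({\bf G},[{\bf X}\ \widetilde{\bf X}]^\top{\bf y})$ for all $i$ and all ${\bf y}\in\mathbb{R}^n$. Let $\boldsymbol W=(W_1,\dots,W_p)$ be a measurable function of $\hat{\boldsymbol\theta}$ that is antisymmetric: for every $F\subseteq\{1,\dots,p\}$, replacing $\hat{\boldsymbol\theta}$ by $P_F\hat{\boldsymbol\theta}$ changes the sign of $W_i$ for $i\in F$ and leaves $W_i$ unchanged for $i\notin F$. For $q\in[0,1]$ let $$T=\min\Big\{t\in\{|W_1|,\dots,|W_p|\}\setminus\{0\}:\ \frac{1+\#\{j:W_j\le -t\}}{\max(\#\{j:W_j\ge t\},1)}\le q\Big\}$$ ($T=+\infty$ if there is no such $t$), and let $\hat{\mathcal S}=\{j:W_j\ge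 T\}$ be the set selected by the knockoff procedure with target FDR $q$. For $\delta\ge0$ let $\mathcal S_0=\{i:|\beta_i|\le\delta\}$ be the set of composite nulls, and let $\mathrm{FDR}=\mathbb{E}\big[|\hat{\mathcal S}\cap\mathcal S_0|/\max(|\hat{\mathcal S}|,1)\big]$. Then $$\mathrm{FDR}\ \le\ \inf_{\epsilon\ge0}\Big\{q\,e^{\epsilon}+\mathbb{P}\Big(\frac{\delta}{\sigma^2}\max_{j\in\mathcal S_0}|\gamma_j-\gamma_j'|>\epsilon\Big)\Big\},$$ where the maximum over an empty $\mathcal S_0$ is $0$. If $q>0$, the infimum is attained, so it is a minimum. If $\delta=0$, the infimum is attained and equals $q$. -/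

import Mathlib

open MeasureTheory ProbabilityTheory

noncomputable section

/-- Swap the coordinates `i` and `i + p` (the left and the right copy of `i`) of a vector in
`ℝ^{2p}` for every `i ∈ F`; this is the action of the permutation matrix `P_F`. -/
def swapPairs {p : ℕ} (F : Finset (Fin p)) (v : Fin p ⊕ Fin p → ℝ) : Fin p ⊕ Fin p → ℝ :=
  Sum.elim (fun i => if i ∈ F then v (Sum.inr i) else v (Sum.inl i))
    (fun i => if i ∈ F then v (Sum.inl i) else v (Sum.inr i))

/-- `Xk` is a (fixed-X) knockoff matrix of the design `X` with parameter vector `s ≥ 0`: the Gram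
matrix of `[X Xk]` is `[[Σ, Σ - diag s], [Σ - diag s, Σ]]` with `Σ = Xᵀ X`. -/
structure IsKnockoff {n p : ℕ} (X Xk : Matrix (Fin n) (Fin p) ℝ) (s : Fin p → ℝ) : Prop where
  nonneg : ∀ i, 0 ≤ s i
  gram : (Matrix.fromCols X Xk).transpose * Matrix.fromCols X Xk =
    Matrix.fromBlocks (X.transpose * X) (X.transpose * X - Matrix.diagonal s)
      (X.transpose * X - Matrix.diagonal s) (X.transpose * X)

/-- The Gram matrix `G = [X Xk]ᵀ [X Xk]` of the augmented design. -/
def augGram {n p : ℕ} (X Xk : Matrix (Fin n) (Fin p) ℝ) :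
    Matrix (Fin p ⊕ Fin p) (Fin p ⊕ Fin p) ℝ :=
  (Matrix.fromCols X Xk).transpose * Matrix.fromCols X Xk

/-- The feature-response products `(γ, γ') = [X Xk]ᵀ y`: `γ_j` is the coordinate `Sum.inl j` and
`γ'_j` is the coordinate `Sum.inr j`. -/
def featureResponse {n p : ℕ} (X Xk : Matrix (Fin n) (Fin p) ℝ) (y : Fin n → ℝ) :
    Fin p ⊕ Fin p → ℝ :=
  (Matrix.fromCols X Xk).transpose.mulVec y

/-- The estimator `θ̂ = T(G, [X Xk]ᵀ y)` satisfies `T(G, P_i [X Xk]ᵀ y) = P_i θ̂` for every `i`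
and every response `y`. -/
def SwapEquivariant {n p : ℕ} (X Xk : Matrix (Fin n) (Fin p) ℝ)
    (T : Matrix (Fin p ⊕ Fin p) (Fin p ⊕ Fin p) ℝ → (Fin p ⊕ Fin p → ℝ) →
      (Fin p ⊕ Fin p → ℝ)) : Prop :=
  ∀ (i : Fin p) (y : Fin n → ℝ),
    T (augGram X Xk) (swapPairs {i} (featureResponse X Xk y)) =
      swapPairs {i} (T (augGram X Xk) (featureResponse X Xk y))

/-- A map from estimates `(θ, θ')` to statistics `(W_1, …, W_p)` is antisymmetric if swapping
`θ_i` and `θ'_i` for all `i ∈ F` switches the signs of the `W_i` with `i ∈ F` and leaves the other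
`W_i` unchanged. -/
def Antisymmetric {p : ℕ} (w : (Fin p ⊕ Fin p → ℝ) → (Fin p → ℝ)) : Prop :=
  ∀ (F : Finset (Fin p)) (θ : Fin p ⊕ Fin p → ℝ) (i : Fin p),
    w (swapPairs F θ) i = if i ∈ F then -(w θ i) else w θ i

/-- The estimated false discovery proportion
`(1 + #{j : W_j ≤ -t}) / max (#{j : W_j ≥ t}) 1`. -/
def fdpHat {p : ℕ} (W : Fin p → ℝ) (t : ℝ) : ℝ :=
  (1 + ((Finset.univ.filter fun j => W j ≤ -t).card : ℝ)) /
    max ((Finset.univ.filter fun j => t ≤ W j).card : ℝ) 1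

/-- The knockoff threshold: the least `t ∈ {|W_i|} \ {0}` with `fdpHat W t ≤ q`, and `⊤ = +∞` if
there is none. -/
def knockoffThreshold {p : ℕ} (q : ℝ) (W : Fin p → ℝ) : WithTop ℝ :=
  (((Finset.univ.image fun i => |W i|).erase 0).filter fun t => fdpHat W t ≤ q).min

/-- The set of variables selected by the knockoff procedure with target FDR `q`. -/
def knockoffSelect {p : ℕ} (q : ℝ) (W : Fin p → ℝ) : Finset (Fin p) :=
  Finset.univ.filter fun j => knockoffThreshold q W ≤ (W j : WithTop ℝ)

/-- The composite nulls `S₀ = {i : |β_i| ≤ δ}`. -/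
def nullSet {p : ℕ} (β : Fin p → ℝ) (δ : ℝ) : Finset (Fin p) :=
  Finset.univ.filter fun i => |β i| ≤ δ

/-- The false discovery rate `E[|S ∩ S₀| / max(|S|, 1)]` of a random selection `S`. -/
def FDR {Ω : Type*} [MeasurableSpace Ω] (P : Measure Ω) {p : ℕ} (S : Ω → Finset (Fin p))
    (S₀ : Finset (Fin p)) : ℝ :=
  ∫ ω, ((S ω ∩ S₀).card : ℝ) / max ((S ω).card : ℝ) 1 ∂P

/-- `q e^ε + P((δ/σ²) max_{j ∈ S₀} |γ_j - γ'_j| > ε)` for a random vector `Γ = (γ, γ')`; the maximum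
over an empty `S₀` is `0`. -/
def naiveBound {Ω : Type*} [MeasurableSpace Ω] (P : Measure Ω) {p : ℕ}
    (Γ : Ω → Fin p ⊕ Fin p → ℝ) (S₀ : Finset (Fin p)) (q δ σ ε : ℝ) : ℝ :=
  q * Real.exp ε +
    P.real {ω | ε < δ / σ ^ 2 * (S₀.sup fun j => ‖Γ ω (Sum.inl j) - Γ ω (Sum.inr j)‖₊ : NNReal)}

end

/-! ### The knockoff threshold and selection -/

section Deterministic

variable {p : ℕ} {q : ℝ}

/-! The argument is a leave-one-out argument combined with an approximate sign symmetry of the null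
statistics.

Deterministic half: give `j` the weight `leaveOneOutWeight`, computed after replacing `W j` by `|W
j|`, so that it does not see the sign of `W j`. Since the estimated FDP at the threshold is at most
`q`, the FDP is at most `q` times the sum of the weights of nulls with `W j > 0`
(`fdp_le_sum_leaveOneOutWeight`). The weights of the indices with `W j < 0` sum to at most `1`
(`sum_leaveOneOutWeight_neg_le_one`). If the signs of the null statistics were fair coins, FDR ≤ `q`
would follow.

Probabilistic half: the signs are only nearly fair. Let `d` be the difference of the `j`-th column
of `X` and its knockoff. By the Gram condition, reflecting `y` in the hyperplane orthogonal to `d`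
swaps `γ_j` and `γ'_j` and changes nothing else, hence flips exactly `W j`. The Gaussian density of
`y` is multiplied by `exp (-β_j (γ_j - γ'_j) / σ²)`. For a null this factor is at least `e^{-ε}` on
the event `B` that `(δ/σ²) max |γ - γ'| ≤ ε`, which the reflection preserves
(`IsKnockoff.setLIntegral_le_exp_mul_reflection`). So positive signs cost at most `e^ε` times
negative ones on `B`, which contributes `q e^ε`; off `B` the FDP is bounded by `1`.

The infimum is attained because the bound is lower semicontinuous in `ε` and, outside a compact
interval, at least its value at `0`. -/

lemma knockoffThreshold_le_iff (W : Fin p → ℝ) (a : ℝ) :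
    knockoffThreshold q W ≤ (a : WithTop ℝ) ↔
      ∃ i, W i ≠ 0 ∧ fdpHat W |W i| ≤ q ∧ |W i| ≤ a := by
  unfold knockoffThreshold Finset.min
  rw [Finset.inf_le_iff (WithTop.coe_lt_top a)]
  constructor
  · rintro ⟨t, ht, hta⟩
    simp only [Finset.mem_filter, Finset.mem_erase, Finset.mem_image, Finset.mem_univ,
      true_and] at ht
    obtain ⟨⟨h0, i, rfl⟩, hq⟩ := ht
    exact ⟨i, abs_ne_zero.1 h0, hq, WithTop.coe_le_coe.1 hta⟩
  · rintro ⟨i, h0, hq, hia⟩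
    refine ⟨|W i|, ?_, WithTop.coe_le_coe.2 hia⟩
    simp only [Finset.mem_filter, Finset.mem_erase, Finset.mem_image, Finset.mem_univ, true_and]
    exact ⟨⟨abs_ne_zero.2 h0, i, rfl⟩, hq⟩

lemma knockoffThreshold_eq_coe {W : Fin p → ℝ} {t : ℝ}
    (h : knockoffThreshold q W = (t : WithTop ℝ)) :
    0 < t ∧ fdpHat W t ≤ q ∧ ∃ i, |W i| = t := by
  have ht := Finset.mem_of_min h
  simp only [Finset.mem_filter, Finset.mem_erase, Finset.mem_image, Finset.mem_univ,
    true_and] at ht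
  obtain ⟨⟨h0, i, rfl⟩, hq⟩ := ht
  exact ⟨lt_of_le_of_ne (abs_nonneg _) (Ne.symm h0), hq, i, rfl⟩

lemma exists_knockoffThreshold_eq_coe {W : Fin p → ℝ} {j : Fin p}
    (hj : j ∈ knockoffSelect q W) :
    ∃ t : ℝ, knockoffThreshold q W = (t : WithTop ℝ) ∧ t ≤ W j := by
  have h : knockoffThreshold q W ≤ (W j : WithTop ℝ) := by
    simpa [knockoffSelect] using hj
  obtain ⟨t, ht⟩ := WithTop.ne_top_iff_exists.1 (h.trans_lt (WithTop.coe_lt_top _)).ne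
  exact ⟨t, ht.symm, by rw [← ht] at h; exact WithTop.coe_le_coe.1 h⟩

lemma pos_of_mem_knockoffSelect {W : Fin p → ℝ} {j : Fin p} (hj : j ∈ knockoffSelect q W) :
    0 < W j := by
  obtain ⟨t, ht, hle⟩ := exists_knockoffThreshold_eq_coe hj
  exact (knockoffThreshold_eq_coe ht).1.trans_le hle

/-- The variables whose statistic is at most minus the knockoff threshold. -/
noncomputable def knockoffReject {p : ℕ} (q : ℝ) (W : Fin p → ℝ) : Finset (Fin p) :=
  Finset.univ.filter fun k => knockoffThreshold q W ≤ ((-W k : ℝ) : WithTop ℝ)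

/-- The statistics `W` with the `j`-th one made nonnegative. -/
noncomputable def absAt {p : ℕ} (W : Fin p → ℝ) (j : Fin p) : Fin p → ℝ := Function.update W j |W j|

/-- The inverse of `1 + #{k : W_k ≤ -T}` if `|W_j| ≥ T` and `0` otherwise, where `T` is the
knockoff threshold that would result if `W_j` were nonnegative. -/
noncomputable def leaveOneOutWeight {p : ℕ} (q : ℝ) (W : Fin p → ℝ) (j : Fin p) : ℝ :=
  if j ∈ knockoffSelect q (absAt W j) then
    (1 + ((knockoffReject q (absAt W j)).card : ℝ))⁻¹ else 0

lemma leaveOneOutWeight_nonneg (W : Fin p → ℝ) (j : Fin p) : 0 ≤ leaveOneOutWeight q W j := by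
  unfold leaveOneOutWeight
  split_ifs <;> positivity

lemma absAt_self {p : ℕ} (W : Fin p → ℝ) (j : Fin p) : absAt W j j = |W j| := by
  simp [absAt]

lemma absAt_of_ne {p : ℕ} (W : Fin p → ℝ) {i j : Fin p} (h : i ≠ j) : absAt W j i = W i := by
  simp [absAt, h]

lemma absAt_update_neg (W : Fin p → ℝ) (j : Fin p) :
    absAt (Function.update W j (-W j)) j = absAt W j := by
  simp [absAt]

/-- This invariance lets a reflection turn the sum over positive null statistics into a sum over
negative ones without touching the weights. -/
lemma leaveOneOutWeight_update_neg (W : Fin p → ℝ) (j : Fin p) :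
    leaveOneOutWeight q (Function.update W j (-W j)) j = leaveOneOutWeight q W j := by
  unfold leaveOneOutWeight
  rw [absAt_update_neg]

/-- The false discovery proportion of the knockoff selection is at most `q` times the sum of the
leave-one-out weights of the nulls with positive statistics. -/
lemma fdp_le_sum_leaveOneOutWeight (hq : 0 ≤ q) (W : Fin p → ℝ) (S₀ : Finset (Fin p)) :
    ((knockoffSelect q W ∩ S₀).card : ℝ) / max ((knockoffSelect q W).card : ℝ) 1 ≤
      q * ∑ j ∈ S₀, if 0 < W j then leaveOneOutWeight q W j else 0 := by
  have hterm : ∀ j ∈ S₀, (if j ∈ knockoffSelect q W then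
      (1 + ((knockoffReject q W).card : ℝ))⁻¹ else 0) ≤
      if 0 < W j then leaveOneOutWeight q W j else 0 := by
    intro j _
    -- A selected `j` has `W j > 0`, so taking the absolute value changes nothing and the weight
    -- uses the actual threshold.
    by_cases hj : j ∈ knockoffSelect q W
    · have hpos := pos_of_mem_knockoffSelect hj
      have habs : absAt W j = W := by simp [absAt, abs_of_pos hpos]
      simp [leaveOneOutWeight, habs, hj, hpos]
    · rw [if_neg hj]
      split_ifs
      · exact leaveOneOutWeight_nonneg W j
      · exact le_rfl
  refine le_trans ?_ (mul_le_mul_of_nonneg_left (Finset.sum_le_sum hterm) hq)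
  rw [← Finset.sum_filter, Finset.sum_const, nsmul_eq_mul, Finset.filter_mem_eq_inter,
    Finset.inter_comm S₀]
  rcases (knockoffSelect q W).eq_empty_or_nonempty with h | ⟨j, hj⟩
  · simp [h]
  obtain ⟨t, ht, -⟩ := exists_knockoffThreshold_eq_coe hj
  obtain ⟨-, hfdp, -⟩ := knockoffThreshold_eq_coe ht
  have hS : (Finset.univ.filter fun j => t ≤ W j) = knockoffSelect q W := by
    simp [knockoffSelect, ht]
  have hN : (Finset.univ.filter fun j => W j ≤ -t) = knockoffReject q W := by
    simp only [knockoffReject, ht, WithTop.coe_le_coe]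
    exact Finset.filter_congr fun _ _ => le_neg
  rw [fdpHat, hS, hN] at hfdp
  have hM : 0 < max ((knockoffSelect q W).card : ℝ) 1 := lt_max_of_lt_right one_pos
  have hR : 0 < 1 + ((knockoffReject q W).card : ℝ) := by positivity
  rw [div_le_iff₀ hM] at hfdp
  rw [div_le_iff₀ hM]
  -- Here `hfdp` reads `1 + #reject ≤ q * max #select 1`.
  calc ((knockoffSelect q W ∩ S₀).card : ℝ)
      = ((knockoffSelect q W ∩ S₀).card : ℝ) * (1 + ((knockoffReject q W).card : ℝ))⁻¹ *
        (1 + ((knockoffReject q W).card : ℝ)) := by field_simp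
    _ ≤ ((knockoffSelect q W ∩ S₀).card : ℝ) * (1 + ((knockoffReject q W).card : ℝ))⁻¹ *
        (q * max ((knockoffSelect q W).card : ℝ) 1) := by gcongr
    _ = _ := by ring

lemma filter_absAt_le_neg {W : Fin p → ℝ} {j : Fin p} {t : ℝ} (ht : 0 < t) :
    (Finset.univ.filter fun i => absAt W j i ≤ -t) =
      (Finset.univ.filter fun i => W i ≤ -t).erase j := by
  ext i
  rcases eq_or_ne i j with rfl | h
  · have := abs_nonneg (W i)
    simp [absAt_self]
    linarith
  · simp [absAt_of_ne W h, h]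

lemma filter_le_absAt {W : Fin p → ℝ} {j : Fin p} {t : ℝ} (hj : t ≤ |W j|) :
    (Finset.univ.filter fun i => t ≤ absAt W j i) =
      insert j (Finset.univ.filter fun i => t ≤ W i) := by
  ext i
  rcases eq_or_ne i j with rfl | h
  · simp [absAt_self, hj]
  · simp [absAt_of_ne W h, h]

lemma card_filter_absAt_le_neg {W : Fin p → ℝ} {j : Fin p} {t : ℝ} (ht : 0 < t)
    (hj : W j ≤ -t) :
    1 + ((Finset.univ.filter fun i => absAt W j i ≤ -t).card : ℝ) =
      (Finset.univ.filter fun i => W i ≤ -t).card := by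
  rw [filter_absAt_le_neg ht]
  have := Finset.card_erase_add_one (s := Finset.univ.filter fun i => W i ≤ -t) (a := j)
    (by simpa using hj)
  rw [← this]
  push_cast
  ring

/-- The `1 +` in the numerator compensates for `j` leaving the negative side, and `j` joins the
positive side. The right-hand side therefore no longer depends on `j`. -/
lemma fdpHat_absAt {W : Fin p → ℝ} {j : Fin p} {t : ℝ} (ht : 0 < t) (hj : W j ≤ -t) :
    fdpHat (absAt W j) t = ((Finset.univ.filter fun i => W i ≤ -t).card : ℝ) /
      max (((Finset.univ.filter fun i => t ≤ W i).card + 1 : ℕ) : ℝ) 1 := by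
  rw [fdpHat, card_filter_absAt_le_neg ht hj, filter_le_absAt (by
    rw [le_abs]; right; linarith), Finset.card_insert_of_notMem]
  simp only [Finset.mem_filter, Finset.mem_univ, true_and, not_le]
  linarith

lemma abs_absAt (W : Fin p → ℝ) (i j : Fin p) : |absAt W j i| = |W i| := by
  rcases eq_or_ne i j with rfl | h
  · simp [absAt]
  · simp [absAt, h]

/-- By `fdpHat_absAt` the estimated FDP at `t` is the same whether `j` or `k` is made nonnegative,
so `t` is an admissible threshold for `k` too. -/
lemma knockoffThreshold_absAt_le {W : Fin p → ℝ} {j k : Fin p} {t : ℝ}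
    (hj : knockoffThreshold q (absAt W j) = (t : WithTop ℝ)) (hjt : W j ≤ -t)
    (hkt : W k ≤ -t) : knockoffThreshold q (absAt W k) ≤ (t : WithTop ℝ) := by
  obtain ⟨ht, hq, i, hi⟩ := knockoffThreshold_eq_coe hj
  rw [knockoffThreshold_le_iff]
  rw [abs_absAt] at hi
  refine ⟨i, ?_, ?_, ?_⟩
  · rw [← abs_ne_zero, abs_absAt, hi]
    exact ht.ne'
  · rwa [abs_absAt, hi, fdpHat_absAt ht hkt, ← fdpHat_absAt ht hjt]
  · rw [abs_absAt, hi]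

/-- The leave-one-out weights of the variables with negative statistics add up to at most one. -/
lemma sum_leaveOneOutWeight_neg_le_one (W : Fin p → ℝ) (S₀ : Finset (Fin p)) :
    (∑ j ∈ S₀, if W j < 0 then leaveOneOutWeight q W j else 0) ≤ 1 := by
  set J := S₀.filter fun j => W j < 0 ∧ j ∈ knockoffSelect q (absAt W j) with hJ
  have hsum : (∑ j ∈ S₀, if W j < 0 then leaveOneOutWeight q W j else 0) =
      ∑ j ∈ J, (1 + ((knockoffReject q (absAt W j)).card : ℝ))⁻¹ := by
    rw [hJ, Finset.sum_filter]
    refine Finset.sum_congr rfl fun j _ => ?_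
    unfold leaveOneOutWeight
    rw [ite_and]
  have hthr : ∀ j ∈ J, ∃ t : ℝ, knockoffThreshold q (absAt W j) = (t : WithTop ℝ) ∧
      0 < t ∧ W j ≤ -t := by
    intro j hj
    obtain ⟨-, hneg, hsel⟩ := Finset.mem_filter.1 hj
    obtain ⟨t, ht, hle⟩ := exists_knockoffThreshold_eq_coe hsel
    refine ⟨t, ht, (knockoffThreshold_eq_coe ht).1, ?_⟩
    have : absAt W j j = -W j := by simp [absAt, abs_of_neg hneg]
    linarith
  rw [hsum]
  rcases J.eq_empty_or_nonempty with h | ⟨j₀, hj₀⟩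
  · simp [h]
  obtain ⟨t, ht, ht0, hjt⟩ := hthr j₀ hj₀
  -- All indices in `J` share one threshold: the smaller of two such thresholds is also admissible
  -- for the index with the larger one, which by minimality forces equality.
  have hall : ∀ j ∈ J, knockoffThreshold q (absAt W j) = (t : WithTop ℝ) ∧ W j ≤ -t := by
    intro j hj
    obtain ⟨u, hu, hu0, hju⟩ := hthr j hj
    rcases le_total t u with h | h
    · have := knockoffThreshold_absAt_le ht hjt (show W j ≤ -t by linarith)
      rw [hu] at this
      obtain rfl := le_antisymm h (WithTop.coe_le_coe.1 this)
      exact ⟨hu, hju⟩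
    · have := knockoffThreshold_absAt_le hu hju (show W j₀ ≤ -u by linarith)
      rw [ht] at this
      obtain rfl := le_antisymm h (WithTop.coe_le_coe.1 this)
      exact ⟨hu, hju⟩
  have hterm : ∀ j ∈ J, (1 + ((knockoffReject q (absAt W j)).card : ℝ))⁻¹ =
      ((Finset.univ.filter fun i => W i ≤ -t).card : ℝ)⁻¹ := by
    intro j hj
    obtain ⟨hT, hle⟩ := hall j hj
    have hR : knockoffReject q (absAt W j) =
        Finset.univ.filter fun i => absAt W j i ≤ -t := by
      simp only [knockoffReject, hT, WithTop.coe_le_coe]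
      exact Finset.filter_congr fun _ _ => le_neg
    rw [hR, card_filter_absAt_le_neg ht0 hle]
  rw [Finset.sum_congr rfl hterm, Finset.sum_const, nsmul_eq_mul, ← div_eq_mul_inv]
  -- Every weight is the inverse of `#{i : W i ≤ -t}`, and `J` is contained in that set.
  refine div_le_one_of_le₀ ?_ (Nat.cast_nonneg _)
  exact_mod_cast Finset.card_le_card fun j hj => by simpa using (hall j hj).2

lemma fdp_le_one (S S₀ : Finset (Fin p)) :
    ((S ∩ S₀).card : ℝ) / max (S.card : ℝ) 1 ≤ 1 := by
  refine div_le_one_of_le₀ (le_max_of_le_left ?_) (by positivity)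
  exact_mod_cast Finset.card_le_card Finset.inter_subset_left

/-! ### Measurability of the selection -/

lemma measurable_card_filter {α : Type*} [MeasurableSpace α] {r : α → Fin p → Prop}
    [∀ a, DecidablePred (r a)] (hr : ∀ j, MeasurableSet {a | r a j}) :
    Measurable fun a => ((Finset.univ.filter (r a)).card : ℝ) := by
  simp_rw [Finset.card_filter, Nat.cast_sum, Nat.cast_ite, Nat.cast_one, Nat.cast_zero]
  exact Finset.measurable_sum _ fun j _ => Measurable.ite (hr j) measurable_const measurable_const

lemma measurable_fdpHat {t : (Fin p → ℝ) → ℝ} (ht : Measurable t) :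
    Measurable fun W : Fin p → ℝ => fdpHat W (t W) := by
  unfold fdpHat
  refine Measurable.div (measurable_const.add (measurable_card_filter fun j => ?_))
    (Measurable.max (measurable_card_filter fun j => ?_) measurable_const)
  · exact measurableSet_le (measurable_pi_apply j) ht.neg
  · exact measurableSet_le ht (measurable_pi_apply j)

lemma measurableSet_knockoffThreshold_le {a : (Fin p → ℝ) → ℝ} (ha : Measurable a) :
    MeasurableSet {W : Fin p → ℝ | knockoffThreshold q W ≤ (a W : WithTop ℝ)} := by
  simp_rw [knockoffThreshold_le_iff, Set.ofPred_exists]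
  refine MeasurableSet.iUnion fun i => ?_
  have habs : Measurable fun W : Fin p → ℝ => |W i| := (measurable_pi_apply i).abs
  refine MeasurableSet.inter ?_ (MeasurableSet.inter ?_ ?_)
  · exact (measurableSet_eq_fun (measurable_pi_apply i) measurable_const).compl
  · exact measurableSet_le (measurable_fdpHat habs) measurable_const
  · exact measurableSet_le habs ha

lemma measurableSet_mem_knockoffSelect (j : Fin p) :
    MeasurableSet {W : Fin p → ℝ | j ∈ knockoffSelect q W} := by
  simpa [knockoffSelect] using measurableSet_knockoffThreshold_le (measurable_pi_apply j)

lemma measurable_absAt (j : Fin p) : Measurable fun W : Fin p → ℝ => absAt W j := by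
  refine measurable_pi_iff.2 fun i => ?_
  rcases eq_or_ne i j with rfl | h
  · simpa [absAt] using (measurable_pi_apply i).abs
  · simpa [absAt, h] using measurable_pi_apply i

lemma measurable_leaveOneOutWeight (j : Fin p) :
    Measurable fun W : Fin p → ℝ => leaveOneOutWeight q W j := by
  unfold leaveOneOutWeight
  refine Measurable.ite (measurable_absAt j (measurableSet_mem_knockoffSelect j)) ?_
    measurable_const
  refine (measurable_const.add ?_).inv
  have : Measurable fun W : Fin p → ℝ => ((knockoffReject q W).card : ℝ) :=
    measurable_card_filter fun k =>
      measurableSet_knockoffThreshold_le (measurable_pi_apply k).neg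
  exact this.comp (measurable_absAt j)

lemma measurable_fdp_knockoffSelect (S₀ : Finset (Fin p)) :
    Measurable fun W : Fin p → ℝ => ((knockoffSelect q W ∩ S₀).card : ℝ) /
      max ((knockoffSelect q W).card : ℝ) 1 := by
  have h1 : Measurable fun W : Fin p → ℝ => ((knockoffSelect q W).card : ℝ) :=
    measurable_card_filter fun k => measurableSet_knockoffThreshold_le (measurable_pi_apply k)
  have h2 : Measurable fun W : Fin p → ℝ => ((knockoffSelect q W ∩ S₀).card : ℝ) := by
    have : ∀ W : Fin p → ℝ, knockoffSelect q W ∩ S₀ =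
        Finset.univ.filter fun j => j ∈ knockoffSelect q W ∧ j ∈ S₀ := by
      intro W; ext j; simp
    simp_rw [this]
    exact measurable_card_filter fun k =>
      (measurableSet_mem_knockoffSelect k).inter (MeasurableSet.const _)
  exact h2.div (h1.max measurable_const)

end Deterministic

/-! ### Gaussian product measures under reflections -/

lemma pi_gaussianReal_eq_withDensity {n : ℕ} (m : Fin n → ℝ) {v : NNReal} (hv : v ≠ 0) :
    Measure.pi (fun i => gaussianReal (m i) v) =
      volume.withDensity fun x : Fin n → ℝ =>
        ENNReal.ofReal (∏ i, gaussianPDFReal (m i) v (x i)) := by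
  refine Measure.pi_eq fun s hs => ?_
  have hint : ∀ i, Integrable (gaussianPDFReal (m i) v) (volume.restrict (s i)) := fun i =>
    (integrable_gaussianPDFReal _ _).restrict
  rw [withDensity_apply _ (MeasurableSet.univ_pi hs), volume_pi, Measure.restrict_pi_pi,
    ← ofReal_integral_eq_lintegral_ofReal (Integrable.fintype_prod_dep hint)
      (Filter.Eventually.of_forall fun x =>
        Finset.prod_nonneg fun i _ => gaussianPDFReal_nonneg _ _ _),
    integral_fintype_prod_eq_prod, ENNReal.ofReal_prod_of_nonneg fun i _ =>
      integral_nonneg fun x => gaussianPDFReal_nonneg _ _ _]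
  exact Finset.prod_congr rfl fun i _ => (gaussianReal_apply_eq_integral _ hv _).symm

/-- The reflection of `ℝⁿ` in the hyperplane orthogonal to `d` (the identity if `d = 0`). -/
noncomputable def hyperplaneReflection {n : ℕ} (d y : Fin n → ℝ) : Fin n → ℝ :=
  y - (2 * (d ⬝ᵥ y) / (d ⬝ᵥ d)) • d

/-- Identifies the explicit formula with an orthogonal reflection of Euclidean space, which is an
isometric involution and hence preserves volume. -/
lemma hyperplaneReflection_eq {n : ℕ} (d y : Fin n → ℝ) :
    hyperplaneReflection d y =
      WithLp.ofLp ((ℝ ∙ (WithLp.toLp 2 d : EuclideanSpace ℝ (Fin n)))ᗮ.reflection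
        (WithLp.toLp 2 y)) := by
  have h1 : inner ℝ (WithLp.toLp 2 d : EuclideanSpace ℝ (Fin n)) (WithLp.toLp 2 y) = d ⬝ᵥ y := by
    rw [EuclideanSpace.inner_toLp_toLp, dotProduct_comm]
    rfl
  have h2 : ‖(WithLp.toLp 2 d : EuclideanSpace ℝ (Fin n))‖ ^ 2 = d ⬝ᵥ d := by
    rw [EuclideanSpace.real_norm_sq_eq]
    simp [dotProduct, sq]
  rw [Submodule.reflection_orthogonal_apply, Submodule.reflection_singleton_apply]
  ext i
  simp only [hyperplaneReflection, h1, RCLike.ofReal_real_eq_id, id, h2]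
  simp
  ring

lemma measurePreserving_hyperplaneReflection {n : ℕ} (d : Fin n → ℝ) :
    MeasurePreserving (hyperplaneReflection d) := by
  have h := ((PiLp.volume_preserving_ofLp (Fin n)).comp
    (LinearIsometryEquiv.measurePreserving
      (ℝ ∙ (WithLp.toLp 2 d : EuclideanSpace ℝ (Fin n)))ᗮ.reflection)).comp
    (PiLp.volume_preserving_toLp (Fin n))
  convert h using 1
  funext y
  exact hyperplaneReflection_eq d y

lemma hyperplaneReflection_hyperplaneReflection {n : ℕ} (d y : Fin n → ℝ) :
    hyperplaneReflection d (hyperplaneReflection d y) = y := by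
  simp [hyperplaneReflection_eq]

lemma prod_gaussianPDFReal {n : ℕ} (m x : Fin n → ℝ) (v : NNReal) :
    ∏ i, gaussianPDFReal (m i) v (x i) =
      (∏ _i : Fin n, (√(2 * Real.pi * v))⁻¹) *
        Real.exp (-((x - m) ⬝ᵥ (x - m)) / (2 * v)) := by
  simp_rw [gaussianPDFReal, Finset.prod_mul_distrib, ← Real.exp_sum, dotProduct]
  congr 2
  rw [← Finset.sum_div, Finset.sum_neg_distrib]
  simp [sq]

/-- The reflection preserves the norm of `x`, so in the squared distance to `m` only the cross term
with `m` changes. -/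
lemma prod_gaussianPDFReal_hyperplaneReflection {n : ℕ} (m d x : Fin n → ℝ) {v : NNReal}
    (hv : v ≠ 0) :
    ∏ i, gaussianPDFReal (m i) v (hyperplaneReflection d x i) =
      (∏ i, gaussianPDFReal (m i) v (x i)) *
        Real.exp (-(2 * (d ⬝ᵥ x) / (d ⬝ᵥ d) * (d ⬝ᵥ m) / v)) := by
  have hv' : (v : ℝ) ≠ 0 := by exact_mod_cast hv
  rw [prod_gaussianPDFReal, prod_gaussianPDFReal, mul_assoc _ (Real.exp _), ← Real.exp_add]
  congr 2
  have key : (hyperplaneReflection d x - m) ⬝ᵥ (hyperplaneReflection d x - m) =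
      (x - m) ⬝ᵥ (x - m) + 2 * (2 * (d ⬝ᵥ x) / (d ⬝ᵥ d)) * (d ⬝ᵥ m) := by
    -- For `d = 0` both sides vanish because division by zero gives `0`, matching the convention
    -- that the reflection is then the identity.
    have hc : 2 * (d ⬝ᵥ x) / (d ⬝ᵥ d) * (2 * (d ⬝ᵥ x) / (d ⬝ᵥ d)) * (d ⬝ᵥ d) =
        2 * (2 * (d ⬝ᵥ x) / (d ⬝ᵥ d)) * (d ⬝ᵥ x) := by
      by_cases h : d ⬝ᵥ d = 0
      · simp [h]
      · field_simp
    simp only [hyperplaneReflection, sub_dotProduct, dotProduct_sub, smul_dotProduct,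
      dotProduct_smul, smul_eq_mul, dotProduct_comm x d, dotProduct_comm m d]
    linear_combination hc
  rw [key]
  field_simp
  ring

/-- Change of variables for a Gaussian vector with independent coordinates of equal variance and
a reflection in a hyperplane. -/
lemma lintegral_comp_hyperplaneReflection {n : ℕ} (m d : Fin n → ℝ) {v : NNReal} (hv : v ≠ 0)
    {F : (Fin n → ℝ) → ENNReal} (hF : Measurable F) :
    ∫⁻ y, F (hyperplaneReflection d y) ∂(Measure.pi fun i => gaussianReal (m i) v) =
      ∫⁻ y, F y * ENNReal.ofReal (Real.exp (-(2 * (d ⬝ᵥ y) / (d ⬝ᵥ d) * (d ⬝ᵥ m) / v)))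
        ∂(Measure.pi fun i => gaussianReal (m i) v) := by
  have hR := measurePreserving_hyperplaneReflection d
  have hdot : Measurable fun y : Fin n → ℝ => d ⬝ᵥ y := by
    unfold dotProduct
    fun_prop
  have hdens : Measurable fun x : Fin n → ℝ =>
      ENNReal.ofReal (∏ i, gaussianPDFReal (m i) v (x i)) :=
    (Finset.measurable_prod _ fun i _ =>
      (measurable_gaussianPDFReal _ _).comp (measurable_pi_apply i)).ennreal_ofReal
  have hE : Measurable fun y : Fin n → ℝ =>
      ENNReal.ofReal (Real.exp (-(2 * (d ⬝ᵥ y) / (d ⬝ᵥ d) * (d ⬝ᵥ m) / v))) := by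
    fun_prop
  rw [pi_gaussianReal_eq_withDensity m hv]
  refine (lintegral_withDensity_eq_lintegral_mul _ hdens (hF.comp hR.measurable)).trans ?_
  refine Eq.trans ?_ (lintegral_withDensity_eq_lintegral_mul _ hdens (hF.mul hE)).symm
  -- Substitute the reflected point under Lebesgue measure: `F ∘ R` becomes `F` by involutivity, and
  -- the density picks up the exponential factor.
  refine (hR.lintegral_comp (hdens.mul (hF.comp hR.measurable))).symm.trans ?_
  refine lintegral_congr fun y => ?_
  simp only [Pi.mul_apply, Function.comp_apply]
  rw [hyperplaneReflection_hyperplaneReflection, prod_gaussianPDFReal_hyperplaneReflection _ _ _ hv,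
    ENNReal.ofReal_mul (Finset.prod_nonneg fun i _ => gaussianPDFReal_nonneg _ _ _)]
  ring

lemma map_eq_pi_gaussianReal {Ω : Type*} [MeasurableSpace Ω] {P : Measure Ω}
    [IsProbabilityMeasure P] {n : ℕ} {z : Fin n → Ω → ℝ} {v : NNReal}
    (hz : ∀ i, HasLaw (z i) (gaussianReal 0 v) P) (hindep : iIndepFun z P)
    {m : Fin n → ℝ} {y : Ω → Fin n → ℝ} (hy : ∀ ω i, y ω i = m i + z i ω) :
    AEMeasurable y P ∧ P.map y = Measure.pi fun i => gaussianReal (m i) v := by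
  have hlaw : ∀ i, HasLaw (fun ω => m i + z i ω) (gaussianReal (m i) v) P := fun i => by
    simpa using gaussianReal_const_add (hz i) (m i)
  have hy' : y = fun ω i => m i + z i ω := by
    funext ω i
    exact hy ω i
  have hind : iIndepFun (fun i ω => m i + z i ω) P :=
    hindep.comp (fun i x => m i + x) fun i => measurable_const.add measurable_id
  constructor
  · rw [hy']
    exact aemeasurable_pi_lambda _ fun i => (hlaw i).aemeasurable
  · rw [hy', (iIndepFun_iff_map_fun_eq_pi_map fun i => (hlaw i).aemeasurable).1 hind]
    congr 1
    funext i
    exact (hlaw i).map_eq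

/-! ### The FDR bound under approximate sign symmetry -/

/-- If flipping the sign of each null statistic changes integrals over `B` by a factor of at most
`e^ε`, the FDR of the knockoff selection is at most `q e^ε` plus the probability of `Bᶜ`. -/
lemma lintegral_fdp_knockoffSelect_le {𝓨 : Type*} [MeasurableSpace 𝓨] (ν : Measure 𝓨)
    [IsProbabilityMeasure ν] {p : ℕ} {q ε : ℝ} (hq : 0 ≤ q) {W : 𝓨 → Fin p → ℝ}
    (hW : Measurable W) (S₀ : Finset (Fin p)) {B : Set 𝓨} (hB : MeasurableSet B)
    (R : Fin p → 𝓨 → 𝓨)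
    (hWR : ∀ j ∈ S₀, ∀ y, W (R j y) = Function.update (W y) j (-W y j))
    (hR : ∀ j ∈ S₀, ∀ F : 𝓨 → ENNReal, Measurable F →
      ∫⁻ y in B, F y ∂ν ≤ ENNReal.ofReal (Real.exp ε) * ∫⁻ y in B, F (R j y) ∂ν) :
    ∫⁻ y, ENNReal.ofReal (((knockoffSelect q (W y) ∩ S₀).card : ℝ) /
        max ((knockoffSelect q (W y)).card : ℝ) 1) ∂ν ≤
      ENNReal.ofReal (q * Real.exp ε) + ν Bᶜ := by
  have hWj : ∀ j, Measurable fun y => W y j := fun j => (measurable_pi_apply j).comp hW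
  have hlw : ∀ j, Measurable fun y => leaveOneOutWeight q (W y) j := fun j =>
    (measurable_leaveOneOutWeight j).comp hW
  have hpos : ∀ j, Measurable fun y =>
      ENNReal.ofReal (if 0 < W y j then leaveOneOutWeight q (W y) j else 0) := fun j =>
    (Measurable.ite (measurableSet_lt measurable_const (hWj j)) (hlw j)
      measurable_const).ennreal_ofReal
  have hneg : ∀ j, Measurable fun y =>
      ENNReal.ofReal (if W y j < 0 then leaveOneOutWeight q (W y) j else 0) := fun j =>
    (Measurable.ite (measurableSet_lt (hWj j) measurable_const) (hlw j)
      measurable_const).ennreal_ofReal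
  rw [← lintegral_add_compl _ hB]
  refine add_le_add ?_ ?_
  · calc ∫⁻ y in B, ENNReal.ofReal (((knockoffSelect q (W y) ∩ S₀).card : ℝ) /
            max ((knockoffSelect q (W y)).card : ℝ) 1) ∂ν
        ≤ ∫⁻ y in B, ENNReal.ofReal q * ∑ j ∈ S₀,
            ENNReal.ofReal (if 0 < W y j then leaveOneOutWeight q (W y) j else 0) ∂ν := by
          refine lintegral_mono fun y => ?_
          rw [← ENNReal.ofReal_sum_of_nonneg, ← ENNReal.ofReal_mul hq]
          · exact ENNReal.ofReal_le_ofReal (fdp_le_sum_leaveOneOutWeight hq _ _)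
          · intro j _
            split_ifs
            exacts [leaveOneOutWeight_nonneg _ _, le_rfl]
      _ = ENNReal.ofReal q * ∑ j ∈ S₀, ∫⁻ y in B,
            ENNReal.ofReal (if 0 < W y j then leaveOneOutWeight q (W y) j else 0) ∂ν := by
          rw [lintegral_const_mul _ (Finset.measurable_sum _ fun j _ => hpos j),
            lintegral_finsetSum _ fun j _ => hpos j]
      _ ≤ ENNReal.ofReal q * ∑ j ∈ S₀, ENNReal.ofReal (Real.exp ε) * ∫⁻ y in B,
            ENNReal.ofReal (if W y j < 0 then leaveOneOutWeight q (W y) j else 0) ∂ν := by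
          gcongr with j hj
          -- Composing with `R j` turns the condition `0 < W j` into `W j < 0` and fixes the weight.
          refine (hR j hj _ (hpos j)).trans (le_of_eq ?_)
          congr 1
          refine lintegral_congr fun y => ?_
          rw [hWR j hj, leaveOneOutWeight_update_neg]
          simp
      _ = ENNReal.ofReal q * ENNReal.ofReal (Real.exp ε) * ∫⁻ y in B, ∑ j ∈ S₀,
            ENNReal.ofReal (if W y j < 0 then leaveOneOutWeight q (W y) j else 0) ∂ν := by
          rw [← Finset.mul_sum, lintegral_finsetSum _ fun j _ => hneg j, mul_assoc]
      _ ≤ ENNReal.ofReal q * ENNReal.ofReal (Real.exp ε) * ∫⁻ _ in B, 1 ∂ν := by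
          gcongr with y
          rw [← ENNReal.ofReal_sum_of_nonneg]
          · exact ENNReal.ofReal_le_one.2 (sum_leaveOneOutWeight_neg_le_one _ _)
          · intro j _
            split_ifs
            exacts [leaveOneOutWeight_nonneg _ _, le_rfl]
      _ ≤ ENNReal.ofReal q * ENNReal.ofReal (Real.exp ε) * 1 := by
          gcongr
          simpa using prob_le_one
      _ = ENNReal.ofReal (q * Real.exp ε) := by rw [mul_one, ENNReal.ofReal_mul hq]
  · calc ∫⁻ y in Bᶜ, ENNReal.ofReal (((knockoffSelect q (W y) ∩ S₀).card : ℝ) /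
            max ((knockoffSelect q (W y)).card : ℝ) 1) ∂ν
        ≤ ∫⁻ _ in Bᶜ, 1 ∂ν :=
          lintegral_mono fun y => ENNReal.ofReal_le_one.2 (fdp_le_one _ _)
      _ = ν Bᶜ := by simp

/-! ### Knockoff matrices and reflections -/

section Knockoff

variable {n p : ℕ} {X Xk : Matrix (Fin n) (Fin p) ℝ} {s : Fin p → ℝ}

/-- The difference of the `j`-th columns of the design and its knockoff. -/
def columnDiff (X Xk : Matrix (Fin n) (Fin p) ℝ) (j : Fin p) : Fin n → ℝ := X.col j - Xk.col j

lemma featureResponse_inl (y : Fin n → ℝ) (j : Fin p) :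
    featureResponse X Xk y (Sum.inl j) = X.col j ⬝ᵥ y := rfl

lemma featureResponse_inr (y : Fin n → ℝ) (j : Fin p) :
    featureResponse X Xk y (Sum.inr j) = Xk.col j ⬝ᵥ y := rfl

lemma columnDiff_dotProduct (y : Fin n → ℝ) (j : Fin p) :
    columnDiff X Xk j ⬝ᵥ y =
      featureResponse X Xk y (Sum.inl j) - featureResponse X Xk y (Sum.inr j) := by
  rw [columnDiff, sub_dotProduct, featureResponse_inl, featureResponse_inr]

lemma measurable_featureResponse : Measurable (featureResponse X Xk) := by
  refine measurable_pi_iff.2 fun a => ?_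
  simp only [featureResponse, Matrix.mulVec, dotProduct]
  fun_prop

namespace IsKnockoff

/-- Together with its knockoff counterpart, this says that the difference of the `j`-th columns is
orthogonal to all other columns of the augmented design, so moving `y` along it affects only `γ_j`
and `γ'_j`. -/
lemma col_dotProduct_columnDiff (h : IsKnockoff X Xk s) (k j : Fin p) :
    X.col k ⬝ᵥ columnDiff X Xk j = Matrix.diagonal s k j := by
  have h11 := congr_fun (congr_fun h.gram (Sum.inl k)) (Sum.inl j)
  have h12 := congr_fun (congr_fun h.gram (Sum.inl k)) (Sum.inr j)
  simp only [Matrix.fromBlocks_apply₁₁, Matrix.fromBlocks_apply₁₂, Matrix.sub_apply] at h11 h12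
  have e12 : X.col k ⬝ᵥ Xk.col j = (X.transpose * X) k j - Matrix.diagonal s k j := h12
  have e11 : X.col k ⬝ᵥ X.col j = (X.transpose * X) k j := h11
  rw [columnDiff, dotProduct_sub, e11, e12]
  ring

lemma knockoffCol_dotProduct_columnDiff (h : IsKnockoff X Xk s) (k j : Fin p) :
    Xk.col k ⬝ᵥ columnDiff X Xk j = -Matrix.diagonal s k j := by
  have h21 := congr_fun (congr_fun h.gram (Sum.inr k)) (Sum.inl j)
  have h22 := congr_fun (congr_fun h.gram (Sum.inr k)) (Sum.inr j)
  simp only [Matrix.fromBlocks_apply₂₁, Matrix.fromBlocks_apply₂₂, Matrix.sub_apply] at h21 h22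
  have e21 : Xk.col k ⬝ᵥ X.col j = (X.transpose * X) k j - Matrix.diagonal s k j := h21
  have e22 : Xk.col k ⬝ᵥ Xk.col j = (X.transpose * X) k j := h22
  rw [columnDiff, dotProduct_sub, e21, e22]
  ring

lemma columnDiff_dotProduct_self (h : IsKnockoff X Xk s) (j : Fin p) :
    columnDiff X Xk j ⬝ᵥ columnDiff X Xk j = 2 * s j := by
  conv_lhs => enter [1]; rw [columnDiff]
  rw [sub_dotProduct, h.col_dotProduct_columnDiff, h.knockoffCol_dotProduct_columnDiff,
    Matrix.diagonal_apply_eq]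
  ring

lemma columnDiff_eq_zero (h : IsKnockoff X Xk s) {j : Fin p} (hs : s j = 0) :
    columnDiff X Xk j = 0 := by
  rw [← dotProduct_self_eq_zero, h.columnDiff_dotProduct_self, hs, mul_zero]

lemma columnDiff_dotProduct_mulVec (h : IsKnockoff X Xk s) (β : Fin p → ℝ) (j : Fin p) :
    columnDiff X Xk j ⬝ᵥ X.mulVec β = s j * β j := by
  have : Matrix.vecMul (columnDiff X Xk j) X = fun k => Matrix.diagonal s k j := by
    funext k
    rw [← h.col_dotProduct_columnDiff, dotProduct_comm]
    rfl
  rw [Matrix.dotProduct_mulVec, this, dotProduct, Finset.sum_eq_single j]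
  · simp
  · intro k _ hk
    simp [Matrix.diagonal_apply_ne _ hk]
  · simp

/-- Reflecting the response swaps the feature-response products of a variable and its knockoff. -/
lemma featureResponse_hyperplaneReflection (h : IsKnockoff X Xk s) (j : Fin p)
    (y : Fin n → ℝ) :
    featureResponse X Xk (hyperplaneReflection (columnDiff X Xk j) y) =
      swapPairs {j} (featureResponse X Xk y) := by
  -- The squared norm of the column difference is `2 * s j`. If `s j = 0`, the column and its
  -- knockoff coincide and both sides are `0`.
  have hmul : 2 * (columnDiff X Xk j ⬝ᵥ y) /
      (columnDiff X Xk j ⬝ᵥ columnDiff X Xk j) * s j =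
      X.col j ⬝ᵥ y - Xk.col j ⬝ᵥ y := by
    rw [← sub_dotProduct, ← columnDiff, h.columnDiff_dotProduct_self]
    by_cases hs : s j = 0
    · simp [h.columnDiff_eq_zero hs]
    · field_simp
  funext a
  rcases a with k | k
  · simp only [featureResponse_inl, swapPairs, Sum.elim_inl, hyperplaneReflection,
      dotProduct_sub, dotProduct_smul, h.col_dotProduct_columnDiff, smul_eq_mul,
      featureResponse_inr, Finset.mem_singleton]
    rcases eq_or_ne k j with rfl | hk
    · rw [if_pos rfl, Matrix.diagonal_apply_eq, hmul]
      ring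
    · rw [if_neg hk, Matrix.diagonal_apply_ne _ hk]
      ring
  · simp only [featureResponse_inl, swapPairs, Sum.elim_inr, hyperplaneReflection,
      dotProduct_sub, dotProduct_smul, h.knockoffCol_dotProduct_columnDiff, smul_eq_mul,
      featureResponse_inr, Finset.mem_singleton]
    rcases eq_or_ne k j with rfl | hk
    · rw [if_pos rfl, Matrix.diagonal_apply_eq, mul_neg, hmul]
      ring
    · rw [if_neg hk, Matrix.diagonal_apply_ne _ hk]
      ring

/-- The log-likelihood ratio of the reflected response is `-β_j (γ_j - γ'_j) / v`. -/
lemma hyperplaneReflection_logRatio (h : IsKnockoff X Xk s) (β : Fin p → ℝ) (j : Fin p)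
    (y : Fin n → ℝ) (v : ℝ) :
    -(2 * (columnDiff X Xk j ⬝ᵥ y) / (columnDiff X Xk j ⬝ᵥ columnDiff X Xk j) *
        (columnDiff X Xk j ⬝ᵥ X.mulVec β) / v) =
      -(β j * (featureResponse X Xk y (Sum.inl j) - featureResponse X Xk y (Sum.inr j)) / v) := by
  rw [h.columnDiff_dotProduct_mulVec, h.columnDiff_dotProduct_self, ← columnDiff_dotProduct]
  by_cases hs : s j = 0
  · simp [h.columnDiff_eq_zero hs]
  · congr 2
    field_simp

end IsKnockoff

/-- The largest `|γ_j - γ'_j|` over `j ∈ S₀` (and `0` if `S₀` is empty). -/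
def maxPairDiff {p : ℕ} (S₀ : Finset (Fin p)) (v : Fin p ⊕ Fin p → ℝ) : NNReal :=
  S₀.sup fun j => ‖v (Sum.inl j) - v (Sum.inr j)‖₊

/-- Makes the event on which the likelihood ratio is controlled invariant under the reflections. -/
lemma maxPairDiff_swapPairs (S₀ F : Finset (Fin p)) (v : Fin p ⊕ Fin p → ℝ) :
    maxPairDiff S₀ (swapPairs F v) = maxPairDiff S₀ v := by
  unfold maxPairDiff
  congr 1
  funext j
  simp only [swapPairs, Sum.elim_inl, Sum.elim_inr]
  split_ifs
  · rw [← nnnorm_neg, neg_sub]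
  · rfl

lemma abs_sub_le_maxPairDiff {S₀ : Finset (Fin p)} {j : Fin p} (hj : j ∈ S₀)
    (v : Fin p ⊕ Fin p → ℝ) :
    |v (Sum.inl j) - v (Sum.inr j)| ≤ maxPairDiff S₀ v := by
  have : ‖v (Sum.inl j) - v (Sum.inr j)‖₊ ≤ maxPairDiff S₀ v :=
    Finset.le_sup (f := fun j => ‖v (Sum.inl j) - v (Sum.inr j)‖₊) hj
  exact_mod_cast this

lemma measurable_maxPairDiff (S₀ : Finset (Fin p)) : Measurable (maxPairDiff S₀) := by
  unfold maxPairDiff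
  exact (Continuous.finset_sup_apply fun j _ => by fun_prop).measurable

end Knockoff

/-! ### The minimum of `q e^ε + P(ε < M)` -/

/-- The tail probability is antitone in `ε` and, by continuity of the measure from below along a
sequence decreasing to `ε₀`, right-continuous; this gives lower semicontinuity. -/
lemma lowerSemicontinuous_measureReal_lt {Ω : Type*} [MeasurableSpace Ω] (P : Measure Ω)
    [IsFiniteMeasure P] (M : Ω → ℝ) :
    LowerSemicontinuous fun ε : ℝ => P.real {ω | ε < M ω} := by
  intro ε₀ c hc
  obtain ⟨u, hu_anti, hu_gt, hu_lim⟩ := exists_seq_strictAnti_tendsto ε₀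
  have hmono : Monotone fun k => {ω | u k < M ω} := fun i j hij ω hω =>
    lt_of_le_of_lt (hu_anti.antitone hij) hω
  have hunion : ⋃ k, {ω | u k < M ω} = {ω | ε₀ < M ω} := by
    ext ω
    simp only [Set.mem_iUnion, Set.mem_ofPred_eq]
    constructor
    · rintro ⟨k, hk⟩
      exact (hu_gt k).trans hk
    · intro h
      exact (hu_lim.eventually_lt_const h).exists
  have hlim : Filter.Tendsto (fun k => P.real {ω | u k < M ω}) Filter.atTop
      (nhds (P.real {ω | ε₀ < M ω})) := by
    have := tendsto_measure_iUnion_atTop (μ := P) hmono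
    rw [hunion] at this
    exact (ENNReal.tendsto_toReal (measure_ne_top _ _)).comp this
  obtain ⟨k, hk⟩ := (hlim.eventually_const_lt hc).exists
  filter_upwards [eventually_lt_nhds (hu_gt k)] with ε hε
  exact hk.trans_le (measureReal_mono fun ω hω => hε.trans hω)

lemma exists_isMinOn_mul_exp_add_measureReal_lt {Ω : Type*} [MeasurableSpace Ω] (P : Measure Ω)
    [IsProbabilityMeasure P] (M : Ω → ℝ) {q : ℝ} (hq : 0 < q) :
    ∃ ε₀, 0 ≤ ε₀ ∧
      IsMinOn (fun ε : ℝ => q * Real.exp ε + P.real {ω | ε < M ω}) (Set.Ici 0) ε₀ := by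
  set f : ℝ → ℝ := fun ε => q * Real.exp ε + P.real {ω | ε < M ω} with hf
  have hlsc : LowerSemicontinuous f :=
    (Continuous.lowerSemicontinuous (by fun_prop)).add (lowerSemicontinuous_measureReal_lt P M)
  -- The cutoff `1 / q` suffices: beyond it `q e^ε ≥ q (1 + 1 / q) = q + 1`, which is at least the
  -- value at `ε = 0`.
  have hK : (0 : ℝ) ≤ 1 / q := by positivity
  obtain ⟨a, ha, hmin⟩ := (hlsc.lowerSemicontinuousOn (Set.Icc 0 (1 / q))).exists_isMinOn
    (Set.nonempty_Icc.2 hK) isCompact_Icc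
  refine ⟨a, ha.1, fun ε hε => ?_⟩
  rcases le_total ε (1 / q) with h | h
  · exact hmin ⟨hε, h⟩
  · have h0 : f a ≤ f 0 := hmin ⟨le_rfl, hK⟩
    have h1 : f 0 ≤ q + 1 := by
      simp only [hf, Real.exp_zero, mul_one]
      gcongr
      exact measureReal_le_one
    have h2 : q + 1 ≤ q * Real.exp ε := by
      have := mul_le_mul_of_nonneg_left ((add_le_add_left h 1).trans (Real.add_one_le_exp ε)) hq.le
      rwa [mul_add, mul_one_div_cancel hq.ne', mul_one, add_comm] at this
    have h3 : q * Real.exp ε ≤ f ε := le_add_of_nonneg_right measureReal_nonneg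
    exact h0.trans (h1.trans (h2.trans h3))

/-! ### Likelihood ratio of a reflected null, and the FDR bound -/

/-- Flipping a null `j` (`|β_j| ≤ δ`) changes the integral over `{δ / v * max |γ - γ'| ≤ ε}` of a
function of the response by a factor of at most `e^ε`. -/
lemma IsKnockoff.setLIntegral_le_exp_mul_reflection {n p : ℕ} {X Xk : Matrix (Fin n) (Fin p) ℝ}
    {s : Fin p → ℝ} (h : IsKnockoff X Xk s) (β : Fin p → ℝ) {δ ε : ℝ} {v : NNReal} (hv : v ≠ 0)
    {j : Fin p} (hj : j ∈ nullSet β δ) {F : (Fin n → ℝ) → ENNReal} (hF : Measurable F)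
    {B : Set (Fin n → ℝ)}
    (hB : B = {y | δ / v * maxPairDiff (nullSet β δ) (featureResponse X Xk y) ≤ ε})
    (hBmeas : MeasurableSet B) :
    ∫⁻ y in B, F y ∂(Measure.pi fun i => gaussianReal (X.mulVec β i) v) ≤
      ENNReal.ofReal (Real.exp ε) * ∫⁻ y in B, F (hyperplaneReflection (columnDiff X Xk j) y)
        ∂(Measure.pi fun i => gaussianReal (X.mulVec β i) v) := by
  set ν := Measure.pi fun i => gaussianReal (X.mulVec β i) v
  have hind : ∀ y, B.indicator (fun y => F (hyperplaneReflection (columnDiff X Xk j) y)) y =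
      B.indicator F (hyperplaneReflection (columnDiff X Xk j) y) := by
    intro y
    have hmem : hyperplaneReflection (columnDiff X Xk j) y ∈ B ↔ y ∈ B := by
      simp only [hB, Set.mem_ofPred_eq, h.featureResponse_hyperplaneReflection,
        maxPairDiff_swapPairs]
    by_cases hyB : y ∈ B
    · rw [Set.indicator_of_mem hyB, Set.indicator_of_mem (hmem.2 hyB)]
    · rw [Set.indicator_of_notMem hyB, Set.indicator_of_notMem (mt hmem.1 hyB)]
  rw [← lintegral_indicator hBmeas, ← lintegral_indicator hBmeas, lintegral_congr hind,
    lintegral_comp_hyperplaneReflection _ _ hv (hF.indicator hBmeas),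
    ← lintegral_const_mul' _ _ ENNReal.ofReal_ne_top]
  refine lintegral_mono fun y => ?_
  by_cases hy : y ∈ B
  · rw [h.hyperplaneReflection_logRatio, mul_left_comm, ← ENNReal.ofReal_mul (Real.exp_nonneg _),
      ← Real.exp_add]
    -- It remains to see that `ε - β_j (γ_j - γ'_j) / v ≥ 0` on `B`, where `|β_j| ≤ δ` and `|γ_j -
    -- γ'_j|` is at most the maximum.
    refine le_mul_of_one_le_right zero_le ?_
    rw [ENNReal.one_le_ofReal, Real.one_le_exp_iff]
    have hβ : |β j| ≤ δ := by simpa [nullSet] using hj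
    have hδ : 0 ≤ δ := (abs_nonneg _).trans hβ
    have hmax := abs_sub_le_maxPairDiff hj (featureResponse X Xk y)
    have hy' : δ / v * maxPairDiff (nullSet β δ) (featureResponse X Xk y) ≤ ε := by
      rw [hB] at hy
      exact hy
    have h1 : β j * (featureResponse X Xk y (Sum.inl j) - featureResponse X Xk y (Sum.inr j)) ≤
        δ * maxPairDiff (nullSet β δ) (featureResponse X Xk y) := by
      refine (le_abs_self _).trans ?_
      rw [abs_mul]
      exact mul_le_mul hβ hmax (abs_nonneg _) hδ
    have h2 := div_le_div_of_nonneg_right h1 v.coe_nonneg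
    rw [mul_div_right_comm δ] at h2
    linarith
  · simp [hy]

theorem mainTheorem4 {Ω : Type*} [MeasurableSpace Ω] (P : Measure Ω) [IsProbabilityMeasure P]
    {n p : ℕ}
    -- the design: normalized columns, invertible Gram matrix, and a knockoff matrix
    (X Xk : Matrix (Fin n) (Fin p) ℝ) (s : Fin p → ℝ)
    (hnorm : ∀ j, ∑ i, X i j ^ 2 = 1)
    (hinv : IsUnit (X.transpose * X))
    (hknock : IsKnockoff X Xk s)
    -- the linear model `y = X β + z` with `z ∼ N(0, σ² I_n)`
    (β : Fin p → ℝ) (σ : ℝ) (hσ : 0 < σ)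
    (z : Fin n → Ω → ℝ)
    (hz : ∀ i, HasLaw (z i) (gaussianReal 0 (Real.toNNReal (σ ^ 2))) P)
    (hindep : iIndepFun z P)
    (y : Ω → Fin n → ℝ) (hy : ∀ ω i, y ω i = X.mulVec β i + z i ω)
    -- the estimator and the antisymmetric statistics
    (T : Matrix (Fin p ⊕ Fin p) (Fin p ⊕ Fin p) ℝ → (Fin p ⊕ Fin p → ℝ) → (Fin p ⊕ Fin p → ℝ))
    (hTmeas : Measurable (T (augGram X Xk)))
    (hT : SwapEquivariant X Xk T)
    (w : (Fin p ⊕ Fin p → ℝ) → (Fin p → ℝ)) (hwmeas : Measurable w) (hw : Antisymmetric w)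
    -- the target level and the width of the composite nulls
    (q : ℝ) (hq0 : 0 ≤ q) (hq1 : q ≤ 1) (δ : ℝ) (hδ : 0 ≤ δ) :
    let Γ : Ω → Fin p ⊕ Fin p → ℝ := fun ω => featureResponse X Xk (y ω)
    let Shat : Ω → Finset (Fin p) := fun ω => knockoffSelect q (w (T (augGram X Xk) (Γ ω)))
    let bound : ℝ → ℝ := naiveBound P Γ (nullSet β δ) q δ σ
    -- the FDR is at most every value of the bound, hence at most its infimum
    (∀ ε, 0 ≤ ε → FDR P Shat (nullSet β δ) ≤ bound ε) ∧
    -- the infimum is a minimum as soon as `q > 0`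
    (0 < q → ∃ ε₀, 0 ≤ ε₀ ∧ IsMinOn bound (Set.Ici 0) ε₀) ∧
    -- for simple nulls the minimum is `q`
    (δ = 0 → IsLeast (bound '' Set.Ici 0) q) := by
  intro Γ Shat bound
  refine ⟨fun ε _ => ?_, fun hq => exists_isMinOn_mul_exp_add_measureReal_lt P _ hq, ?_⟩
  · set v : NNReal := Real.toNNReal (σ ^ 2) with hvdef
    have hvσ : (v : ℝ) = σ ^ 2 := Real.coe_toNNReal _ (sq_nonneg σ)
    have hv : v ≠ 0 := by
      rw [← NNReal.coe_ne_zero, hvσ]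
      positivity
    obtain ⟨hyae, hymap⟩ := map_eq_pi_gaussianReal hz hindep hy
    set ν := Measure.pi fun i => gaussianReal (X.mulVec β i) v
    set W : (Fin n → ℝ) → Fin p → ℝ := fun x => w (T (augGram X Xk) (featureResponse X Xk x))
    have hW : Measurable W := hwmeas.comp (hTmeas.comp measurable_featureResponse)
    set B : Set (Fin n → ℝ) :=
      {x | δ / v * maxPairDiff (nullSet β δ) (featureResponse X Xk x) ≤ ε} with hB
    have hBmeas : MeasurableSet B := by
      refine measurableSet_le (measurable_const.mul ?_) measurable_const
      exact ((measurable_maxPairDiff _).comp measurable_featureResponse).coe_nnreal_real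
    have hflip : ∀ j ∈ nullSet β δ, ∀ x, W (hyperplaneReflection (columnDiff X Xk j) x) =
        Function.update (W x) j (-W x j) := by
      intro j _ x
      funext i
      simp only [W]
      -- The reflection swaps the pair in `(γ, γ')`, equivariance carries the swap to the estimate,
      -- and antisymmetry turns it into a sign flip.
      rw [hknock.featureResponse_hyperplaneReflection, hT, hw]
      rcases eq_or_ne i j with rfl | hij <;> simp [*]
    have hmain := lintegral_fdp_knockoffSelect_le ν hq0 hW (nullSet β δ) hBmeas
      (fun j => hyperplaneReflection (columnDiff X Xk j)) hflip
      (fun j hj F hF => hknock.setLIntegral_le_exp_mul_reflection β hv hj hF hB hBmeas)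
    have hfdp := (measurable_fdp_knockoffSelect (q := q) (nullSet β δ)).comp hW
    have hprob : ν Bᶜ = P {ω | ε < δ / σ ^ 2 * maxPairDiff (nullSet β δ) (Γ ω)} := by
      rw [← hymap, Measure.map_apply_of_aemeasurable hyae hBmeas.compl, hB, hvσ]
      congr 1
      ext ω
      simp [Γ]
    -- Transfer the bound from the law of the response back to the underlying probability space.
    rw [← hymap, lintegral_map' (by
      rw [hymap]
      exact hfdp.ennreal_ofReal.aemeasurable) hyae, hymap, hprob] at hmain
    have hFDR : FDR P Shat (nullSet β δ) = (∫⁻ ω, ENNReal.ofReal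
        (((knockoffSelect q (W (y ω)) ∩ nullSet β δ).card : ℝ) /
          max ((knockoffSelect q (W (y ω))).card : ℝ) 1) ∂P).toReal :=
      integral_eq_lintegral_of_nonneg_ae
        (Filter.Eventually.of_forall fun ω => by positivity)
        (hfdp.comp_aemeasurable hyae).aestronglyMeasurable
    rw [hFDR]
    refine (ENNReal.toReal_mono (by finiteness) hmain).trans (le_of_eq ?_)
    rw [ENNReal.toReal_add (by finiteness) (by finiteness),
      ENNReal.toReal_ofReal (by positivity)]
    rfl
  · intro h0
    -- With `δ = 0` the event is `ε < 0`, which is empty, so the bound is smallest at `ε = 0`.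
    have hbound : ∀ ε, 0 ≤ ε → bound ε = q * Real.exp ε := by
      intro ε hε
      simp [bound, naiveBound, h0, not_lt.2 hε]
    refine ⟨⟨0, Set.mem_Ici.2 le_rfl, by simp [hbound]⟩, ?_⟩
    rintro _ ⟨ε, hε, rfl⟩
    rw [hbound ε hε]
    exact le_mul_of_one_le_right hq0 (Real.one_le_exp hε)
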